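/- Let $q$ be a prime power, let $\mathbb{P}^2$ be the projective plane over $\mathbb{F}_{q^2}$ with coordinates $(x:y:z)$, and let $X\subseteq\mathbb{P}^2$ be the Hermitian curve $y^qz+yz^q=x^{q+1}$ (affine equation $y^q+y=x^{q+1}$). Let $P_\infty=(0:1:0)$ be its only point at infinity and $B=X(\mathbb{F}_{q^2})\setminus\{P_\infty\}$. For integers $d>0$, $a\ge 0$, let $H^0(X,\mathcal{O}_X(d)(-aP_\infty))$ be the space of degree $d$ homogeneous forms on $X$ that vanish on the scheme $aP_\infty\subseteq X$ (the divisor $a P_\infty$ of $X$), and let $C(d,a)\subseteq\mathbb{F}_{q^2}^{B}$ be the code obtained by evaluating these forms at the points of $B$, each written as $(x:y:1)$. Let $C(d,a)^\perp$ be its dual code with respect to the standard product $v\cdot w=\sum_{P\in B}v_Pw_P$. Let $1\le d\le q-1$ and $0\le a\le d$. Let $\delta$ be the minimum distance of $C(d,a)^\perp$ and let $A_\delta$ be the number of its minimum-weight codewords, that is, of the nonzero codewords of Hamming weight $\delta$. 1. If $a=0$, then $\delta=d+2$. A subset $S\subseteq B$ is the support of a minimum-weight codeword of $C(d,a)^\perp$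 if and only if $|S|=\delta$ and the points of $S$ are collinear in $\mathbb{P}^2$. Moreover, $$\frac{A_\delta}{q^2-1}=\begin{cases} q^4-q^3 & \text{if } d=q-1,\\[2pt] q^2\binom{q}{\delta}+(q^4-q^3)\binom{q+1}{\delta} & \text{if } d<q-1.\end{cases}$$ 2. If $a>0$, then $\delta=d+1$. A subset $S\subseteq B$ is the support of a minimum-weight codeword of $C(d,a)^\perp$ if and only if $|S|=\delta$ and the points of $\{P_\infty\}\cup S$ are collinear in $\mathbb{P}^2$. Moreover, $$\frac{A_\delta}{q^2-1}=q^2\binom{q}{\delta}.$$ -/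

import Mathlib

open scoped LinearAlgebra.Projectivization

/-! ### Linear codes of length `n = |ι|` over a field -/

namespace LinCode

variable {ι K : Type*} [Fintype ι] [Field K]

/-- The dual code `C^⊥ = {v | v · c = 0 for all c ∈ C}`. -/
def dual (C : Submodule K (ι → K)) : Submodule K (ι → K) where
  carrier := {v | ∀ c ∈ C, ∑ i, v i * c i = 0}
  zero_mem' := by
    intro c _
    simp
  add_mem' := by
    intro v w hv hw c hc
    simp only [Pi.add_apply, add_mul, Finset.sum_add_distrib, hv c hc, hw c hc, add_zero]
  smul_mem' := by
    intro r v hv c hc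
    simp only [Pi.smul_apply, smul_eq_mul, mul_assoc, ← Finset.mul_sum, hv c hc, mul_zero]

variable [DecidableEq K]

/-- The minimum distance of a code: the least Hamming distance between two distinct codewords
(`⊤` for the zero code). -/
noncomputable def minDist (C : Submodule K (ι → K)) : ℕ∞ :=
  ⨅ (v ∈ C) (w ∈ C) (_ : v ≠ w), (hammingDist v w : ℕ∞)

/-- A minimum-weight codeword: a nonzero codeword whose weight is the minimum distance. -/
def IsMinWeight (C : Submodule K (ι → K)) (v : ι → K) : Prop :=
  v ∈ C ∧ v ≠ 0 ∧ (hammingNorm v : ℕ∞) = minDist C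

/-- `S` is the support of a minimum-weight codeword of `C`. -/
def IsMinWeightSupport (C : Submodule K (ι → K)) (S : Finset ι) : Prop :=
  ∃ v, IsMinWeight C v ∧ Function.support v = (S : Set ι)

/-- The number of minimum-weight codewords of `C`. -/
noncomputable def numMinWeight (C : Submodule K (ι → K)) : ℕ :=
  {v : ι → K | IsMinWeight C v}.ncard

end LinCode

/-! ### The Hermitian curve and the codes `C(d,a)`

Homogeneous coordinates `(x : y : z)` of the plane are indexed by `0, 1, 2 : Fin 3`. -/

namespace Hermitian

open MvPolynomial

variable (K : Type*) [Field K] (q : ℕ)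

/-- The form `y^q z + y z^q - x^(q+1)`, whose affine equation (`z = 1`) is
`y^q + y = x^(q+1)`. -/
noncomputable def curveForm : MvPolynomial (Fin 3) K :=
  X 1 ^ q * X 2 + X 1 * X 2 ^ q - X 0 ^ (q + 1)

/-- The `K`-rational points of the Hermitian curve in the projective plane over `K`. -/
def rationalPoints : Set (ℙ K (Fin 3 → K)) :=
  {P | eval P.rep (curveForm K q) = 0}

/-- The point `(0 : 1 : 0)`. -/
noncomputable def pInfty : ℙ K (Fin 3 → K) :=
  Projectivization.mk K ![0, 1, 0] (fun h => one_ne_zero (congrFun h 1))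

/-- The set `B` of all rational points of the curve other than the point at infinity. -/
def affinePoints : Set (ℙ K (Fin 3 → K)) :=
  rationalPoints K q \ {pInfty K}

noncomputable instance [Fintype K] : Fintype (affinePoints K q) :=
  Fintype.ofFinite _

/-- Dehomogenization in the chart `y ≠ 0`, which contains `(0 : 1 : 0)` as its origin:
`f ↦ f(x, 1, z)`, where `x, z` are the variables `0, 1 : Fin 2`. -/
noncomputable def dehomog : MvPolynomial (Fin 3) K →ₐ[K] MvPolynomial (Fin 2) K :=
  aeval ![X 0, 1, X 1]

/-- The affine coordinate ring of the part of the curve in the chart `y ≠ 0`. -/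
abbrev ChartRing : Type _ :=
  MvPolynomial (Fin 2) K ⧸ Ideal.span {dehomog K (curveForm K q)}

/-- Restriction of a form to the curve in the chart `y ≠ 0`. -/
noncomputable def toChart : MvPolynomial (Fin 3) K →ₐ[K] ChartRing K q :=
  (Ideal.Quotient.mkₐ K (Ideal.span {dehomog K (curveForm K q)})).comp (dehomog K)

/-- The maximal ideal `(x, z)` of the point `(0 : 1 : 0)` in the coordinate ring of the chart.
As the curve is smooth there, its `a`-th power is the ideal of the divisor `a • P_∞`, seen as a
closed subscheme of the curve. -/
noncomputable def idealPInfty : Ideal (ChartRing K q) :=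
  Ideal.span {Ideal.Quotient.mk _ (X 0), Ideal.Quotient.mk _ (X 1)}

/-- Forms of degree `d` whose restriction to the curve vanishes on the scheme `a • P_∞`; their
restrictions to the curve are the elements of `H⁰(X, 𝒪_X(d)(-a P_∞))`. -/
noncomputable def sections (d a : ℕ) : Submodule K (MvPolynomial (Fin 3) K) :=
  homogeneousSubmodule (Fin 3) K d ⊓
    ((idealPInfty K q ^ a).restrictScalars K).comap (toChart K q).toLinearMap

/-- The representative of a point with last coordinate `1` (for points off the line `z = 0`,
hence for all points of `B`). -/
noncomputable def affineRep (P : ℙ K (Fin 3 → K)) : Fin 3 → K :=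
  (P.rep 2)⁻¹ • P.rep

/-- Evaluation at the points of `B`, each represented by `(x, y, 1)`. -/
noncomputable def evalMap : MvPolynomial (Fin 3) K →ₗ[K] (affinePoints K q → K) :=
  LinearMap.pi fun P => (aeval (affineRep K P.1)).toLinearMap

/-- The code `C(d,a)` obtained by evaluating `H⁰(X, 𝒪_X(d)(-a P_∞))` on `B`. -/
noncomputable def code (d a : ℕ) : Submodule K (affinePoints K q → K) :=
  (sections K q d a).map (evalMap K q)

end Hermitian

/-!
A product of `e` lines separates a point of `B` from any `e` others. If `e + 2` points are not
collinear, a line through two of them missing a third point `P`, together with `e - 1` further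
lines, separates `P` from all the others. Hence nonzero words of `C(e,0)^⊥` have weight at least
`e + 2`, and those of weight `e + 2` have collinear support. Conversely, a form of degree `d`
restricts to a polynomial of degree at most `d` on a line, so the Lagrange weights of any `d + 2`
points of the line form a dual word.

If `0 < a ≤ d < q`, then multiplication by `z`, which vanishes to order at least `q` at `P_∞`,
embeds `C(d-1,0)` into `C(d,a)`, and the above applies with `e = d - 1`. A product of `d` lines
through `P_∞` belongs to `C(d,a)`, which forces the support of a word of weight `d + 1` onto a line
through `P_∞`. On such a line the leading coefficient of a section is its value at `P_∞`, namely
`0`, so `d + 1` points suffice for a dual word.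

Words of minimum weight with the same support are proportional, so it remains to count subsets of
lines. The line `x = c` contains `q` points of `B`, one for each element of trace `c^(q+1)`;
substituting `x = u + m^q`, the line `y = m x + b` becomes `u^(q+1) = b^q + b + m^(q+1)`, with one
solution if the right-hand side vanishes and `q + 1` otherwise.
-/

section Counting

theorem card_fiber_eq_of_card_eq_mul {α β : Type*} [DecidableEq β] {s : Finset α} {t : Finset β}
    {f : α → β} {n m : ℕ} (hf : ∀ x ∈ s, f x ∈ t) (hn : ∀ b ∈ t, {x ∈ s | f x = b}.card ≤ n)
    (ht : t.card ≤ m) (hs : s.card = m * n) {b : β} (hb : b ∈ t) :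
    {x ∈ s | f x = b}.card = n := by
  have hsum : ∑ b ∈ t, {x ∈ s | f x = b}.card = ∑ _b ∈ t, n := by
    refine (Finset.sum_le_sum hn).antisymm ?_
    rw [← Finset.card_eq_sum_card_fiberwise hf, hs, Finset.sum_const, smul_eq_mul]
    exact Nat.mul_le_mul_right n ht
  exact (Finset.sum_eq_sum_iff_of_le hn).1 hsum b hb

theorem card_filter_eval_eq_zero_le {R : Type*} [CommRing R] [IsDomain R] [Fintype R]
    [DecidableEq R] {p : Polynomial R} (hp : p ≠ 0) :
    ({x | p.eval x = 0} : Finset R).card ≤ p.natDegree :=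
  Polynomial.card_le_degree_of_subset_roots fun x hx => by simpa [hp] using hx

theorem ncard_subsets_of_lines {L B : Type*} [Fintype L] {ℓ : L → Finset B}
    (hℓ : ∀ {i j : L} {P Q : B}, P ≠ Q → P ∈ ℓ i → Q ∈ ℓ i → P ∈ ℓ j → Q ∈ ℓ j → i = j)
    {k : ℕ} (hk : 2 ≤ k) :
    {S : Finset B | S.card = k ∧ ∃ i, S ⊆ ℓ i}.ncard = ∑ i, (ℓ i).card.choose k := by
  classical
  have hunion : {S : Finset B | S.card = k ∧ ∃ i, S ⊆ ℓ i} =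
      (Finset.univ.biUnion fun i => (ℓ i).powersetCard k : Finset (Finset B)) := by
    ext S
    simp [Finset.mem_powersetCard, and_comm]
  have hdisj : Set.PairwiseDisjoint (Finset.univ : Finset L)
      fun i => (ℓ i).powersetCard k := by
    refine fun i _ j _ hij => Finset.disjoint_left.2 fun S hSi hSj => hij ?_
    rw [Finset.mem_powersetCard] at hSi hSj
    obtain ⟨P, hP, Q, hQ, hPQ⟩ := Finset.one_lt_card.1 (hk.trans hSi.2.ge)
    exact hℓ hPQ (hSi.1 hP) (hSi.1 hQ) (hSj.1 hP) (hSj.1 hQ)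
  rw [hunion, Set.ncard_coe_finset, Finset.card_biUnion hdisj]
  simp only [Finset.card_powersetCard]

end Counting

namespace Hermitian

section TraceNorm

variable {K : Type*} [Field K] [Fintype K] {q : ℕ} (hK : Fintype.card K = q ^ 2)

include hK

theorem one_lt_of_card_eq_sq : 1 < q := by
  have hlt := Fintype.one_lt_card (α := K)
  rw [hK] at hlt
  exact (one_lt_sq_iff₀ q.zero_le).1 hlt

theorem pow_pow_eq_self (x : K) : (x ^ q) ^ q = x := by
  rw [← pow_mul, ← sq, ← hK, FiniteField.pow_card]

theorem exists_ringHom_eq_pow : ∃ φ : K →+* K, ∀ x, φ x = x ^ q := by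
  obtain ⟨p, _⟩ := CharP.exists K
  obtain ⟨m, hp, hm⟩ := FiniteField.card K p
  have : Fact p.Prime := ⟨hp⟩
  obtain ⟨n, -, rfl⟩ := (Nat.dvd_prime_pow hp).1 (Dvd.intro_left q (by rw [← sq, ← hK, hm]))
  exact ⟨iterateFrobenius K p n, iterateFrobenius_def p n⟩

theorem add_pow_eq (x y : K) : (x + y) ^ q = x ^ q + y ^ q := by
  obtain ⟨φ, hφ⟩ := exists_ringHom_eq_pow hK
  simp only [← hφ, map_add]

theorem sub_pow_eq (x y : K) : (x - y) ^ q = x ^ q - y ^ q := by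
  obtain ⟨φ, hφ⟩ := exists_ringHom_eq_pow hK
  simp only [← hφ, map_sub]

theorem neg_pow_eq (x : K) : (-x) ^ q = -x ^ q := by
  obtain ⟨φ, hφ⟩ := exists_ringHom_eq_pow hK
  simp only [← hφ, map_neg]

theorem trace_pow_eq (x : K) : (x ^ q + x) ^ q = x ^ q + x := by
  rw [add_pow_eq hK, pow_pow_eq_self hK, add_comm]

theorem norm_pow_eq (x : K) : (x ^ (q + 1)) ^ q = x ^ (q + 1) := by
  rw [pow_succ, mul_pow, pow_pow_eq_self hK, mul_comm]

variable [DecidableEq K]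

theorem card_pow_eq_self_le : ({e | e ^ q = e} : Finset K).card ≤ q := by
  have hq := one_lt_of_card_eq_sq hK
  have hle := card_filter_eval_eq_zero_le (FiniteField.X_pow_card_sub_X_ne_zero K hq)
  rw [FiniteField.X_pow_card_sub_X_natDegree_eq K hq] at hle
  simpa [sub_eq_zero] using hle

theorem card_trace_fiber {e : K} (he : e ^ q = e) :
    ({y | y ^ q + y = e} : Finset K).card = q := by
  have hq := one_lt_of_card_eq_sq hK
  have hfiber (b : K) : ({y | y ^ q + y = b} : Finset K).card ≤ q := by
    have hdeg : (Polynomial.X ^ q + (Polynomial.X - Polynomial.C b)).natDegree = q := by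
      rw [Polynomial.natDegree_add_eq_left_of_natDegree_lt] <;>
        simp only [Polynomial.natDegree_X_pow, Polynomial.natDegree_X_sub_C, hq]
    have hle := card_filter_eval_eq_zero_le
      (Polynomial.ne_zero_of_natDegree_gt (hq.trans_eq hdeg.symm))
    rw [hdeg] at hle
    simpa [← add_sub_assoc, sub_eq_zero] using hle
  exact card_fiber_eq_of_card_eq_mul (t := {e | e ^ q = e}) (m := q)
    (fun y _ => by simpa using trace_pow_eq hK y) (fun b _ => hfiber b) (card_pow_eq_self_le hK)
    (by rw [Finset.card_univ, hK, sq]) (by simpa using he)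

theorem card_norm_fiber {e : K} (he : e ^ q = e) (he0 : e ≠ 0) :
    ({x | x ^ (q + 1) = e} : Finset K).card = q + 1 := by
  have hq := one_lt_of_card_eq_sq hK
  have hfiber (b : K) : ({x | x ^ (q + 1) = b} : Finset K).card ≤ q + 1 := by
    have hle := card_filter_eval_eq_zero_le (Polynomial.X_pow_sub_C_ne_zero q.succ_pos b)
    rw [Polynomial.natDegree_X_pow_sub_C] at hle
    simpa [sub_eq_zero] using hle
  have hne : ({x | x ^ (q + 1) = e} : Finset K) =
      {x ∈ Finset.univ.erase (0 : K) | x ^ (q + 1) = e} := by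
    ext x
    have : x ^ (q + 1) = e → x ≠ 0 := by
      rintro rfl rfl
      exact he0 (zero_pow q.succ_ne_zero)
    simpa
  rw [hne]
  refine card_fiber_eq_of_card_eq_mul (t := ({e | e ^ q = e} : Finset K).erase 0) (m := q - 1)
    (fun x hx => ?_) (fun b _ => ?_) ?_ ?_ (by simp [he0, he])
  · simpa [norm_pow_eq hK x] using hx
  · exact (Finset.card_le_card (Finset.filter_subset_filter _ (Finset.subset_univ _))).trans
      (hfiber b)
  · rw [Finset.card_erase_of_mem (by simp [(zero_lt_one.trans hq).ne'])]
    exact Nat.sub_le_sub_right (card_pow_eq_self_le hK) 1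
  · rw [Finset.card_erase_of_mem (Finset.mem_univ _), Finset.card_univ, hK, mul_comm,
      ← Nat.sq_sub_sq, one_pow]

end TraceNorm

end Hermitian

namespace LinCode

variable {ι K : Type*} [Fintype ι] [Field K]

theorem dual_anti {C C' : Submodule K (ι → K)} (h : C ≤ C') : dual C' ≤ dual C :=
  fun _ hv c hc => hv c (h hc)

theorem apply_eq_zero_of_mem_dual {C : Submodule K (ι → K)} {v c : ι → K} (hv : v ∈ dual C)
    (hc : c ∈ C) {i : ι} (hci : c i ≠ 0) (h : ∀ j, j ≠ i → v j ≠ 0 → c j = 0) : v i = 0 := by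
  have hsum : ∑ j, v j * c j = v i * c i := by
    refine Fintype.sum_eq_single i fun j hj => ?_
    by_cases hvj : v j = 0
    · rw [hvj, zero_mul]
    · rw [h j hj hvj, mul_zero]
  exact (mul_eq_zero.1 (hsum ▸ hv c hc)).resolve_right hci

/- The Lagrange weights `∏ j ≠ i, (t i - t j)⁻¹` express the coefficient of degree `|S| - 1` of an
interpolating polynomial. -/
theorem exists_mem_dual_support_eq {C : Submodule K (ι → K)} {S : Finset ι} {t : ι → K}
    (ht : Set.InjOn t S) (h : ∀ c ∈ C, ∃ F : Polynomial K, F.degree < S.card ∧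
      F.coeff (S.card - 1) = 0 ∧ ∀ i ∈ S, F.eval (t i) = c i) :
    ∃ v ∈ dual C, Function.support v = S := by
  classical
  refine ⟨fun i => if i ∈ S then Lagrange.nodalWeight S t i else 0, fun c hc => ?_, ?_⟩
  · obtain ⟨F, hdeg, hF, hev⟩ := h c hc
    rw [Lagrange.coeff_eq_sum ht hdeg] at hF
    simp only [ite_mul, zero_mul, Finset.sum_ite_mem, Finset.univ_inter]
    rw [← hF]
    refine Finset.sum_congr rfl fun i hi => ?_
    rw [hev i hi, Lagrange.nodalWeight, Finset.prod_inv_distrib, div_eq_mul_inv, mul_comm]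
  · ext i
    by_cases hi : i ∈ S
    · simpa [hi] using Lagrange.nodalWeight_ne_zero ht hi
    · simp [hi]

variable [DecidableEq K]

theorem hammingNorm_eq_ncard_support (v : ι → K) :
    hammingNorm v = (Function.support v).ncard := by
  rw [hammingNorm, ← Set.ncard_coe_finset]
  congr 1
  ext i
  simp

theorem hammingNorm_eq_card_of_support_eq {v : ι → K} {S : Finset ι}
    (h : Function.support v = S) : hammingNorm v = S.card := by
  rw [hammingNorm_eq_ncard_support, h, Set.ncard_coe_finset]

theorem minDist_le_hammingNorm {D : Submodule K (ι → K)} {v : ι → K} (hv : v ∈ D) (hv0 : v ≠ 0) :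
    minDist D ≤ hammingNorm v := by
  refine (iInf₂_le v hv).trans ((iInf₂_le 0 D.zero_mem).trans ((iInf_le _ hv0).trans ?_))
  rw [hammingDist_zero_right]

theorem minDist_eq_of_forall_le {D : Submodule K (ι → K)} {δ : ℕ}
    (hle : ∀ v ∈ D, v ≠ 0 → δ ≤ hammingNorm v) (hex : ∃ v ∈ D, v ≠ 0 ∧ hammingNorm v = δ) :
    minDist D = δ := by
  obtain ⟨v, hv, hv0, hvδ⟩ := hex
  refine (hvδ ▸ minDist_le_hammingNorm hv hv0).antisymm ?_
  refine le_iInf₂ fun v hv => le_iInf₂ fun w hw => le_iInf fun hvw => ?_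
  rw [hammingDist_eq_hammingNorm]
  exact_mod_cast hle _ (D.add_mem (D.neg_mem hv) hw) fun h => hvw (neg_add_eq_zero.1 h)

theorem isMinWeightSupport_iff {D : Submodule K (ι → K)} {δ : ℕ} (hδ : δ ≠ 0)
    (hmin : minDist D = δ) {S : Finset ι} :
    IsMinWeightSupport D S ↔ S.card = δ ∧ ∃ v ∈ D, Function.support v = S := by
  constructor
  · rintro ⟨v, ⟨hv, -, hvδ⟩, hvS⟩
    rw [hmin, hammingNorm_eq_card_of_support_eq hvS] at hvδ
    exact ⟨by exact_mod_cast hvδ, v, hv, hvS⟩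
  · rintro ⟨hS, v, hv, hvS⟩
    have hvδ : hammingNorm v = δ := (hammingNorm_eq_card_of_support_eq hvS).trans hS
    exact ⟨v, ⟨hv, hammingNorm_ne_zero_iff.1 (hvδ ▸ hδ), by rw [hvδ, hmin]⟩, hvS⟩

theorem IsMinWeight.smul {D : Submodule K (ι → K)} {v : ι → K} (hv : IsMinWeight D v) {r : K}
    (hr : r ≠ 0) : IsMinWeight D (r • v) := by
  refine ⟨D.smul_mem r hv.1, smul_ne_zero hr hv.2.1, ?_⟩
  rw [hammingNorm_smul (fun _ => IsSMulRegular.of_ne_zero hr), hv.2.2]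

theorem IsMinWeight.exists_smul_eq {D : Submodule K (ι → K)} {v w : ι → K}
    (hv : IsMinWeight D v) (hw : IsMinWeight D w)
    (h : Function.support v = Function.support w) : ∃ r : K, r ≠ 0 ∧ r • v = w := by
  obtain ⟨i, hvi : v i ≠ 0⟩ := Function.ne_iff.1 hv.2.1
  have hwi : w i ≠ 0 := (Set.ext_iff.1 h i).1 hvi
  have hi : (w - (w i / v i) • v) i = 0 := by simp [hvi]
  refine ⟨w i / v i, div_ne_zero hwi hvi, ?_⟩
  by_contra hne
  have hss : Function.support (w - (w i / v i) • v) ⊂ Function.support w := by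
    refine (Set.ssubset_iff_of_subset fun j hj => ?_).2 ⟨i, hwi, fun h => h hi⟩
    by_contra hwj
    have hvj := mt (Set.ext_iff.1 h j).1 hwj
    rw [Function.notMem_support] at hvj hwj
    exact hj (by simp [hvj, hwj])
  have hlt := Set.ncard_lt_ncard hss
  have hle := minDist_le_hammingNorm (D.sub_mem hw.1 (D.smul_mem (w i / v i) hv.1))
    (sub_ne_zero.2 (Ne.symm hne))
  rw [← hw.2.2, hammingNorm_eq_ncard_support, hammingNorm_eq_ncard_support, Nat.cast_le] at hle
  exact hle.not_gt hlt

theorem numMinWeight_eq_mul [Fintype K] (D : Submodule K (ι → K)) :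
    numMinWeight D = {S : Finset ι | IsMinWeightSupport D S}.ncard * (Fintype.card K - 1) := by
  choose! g hg hgS using fun (S : Finset ι) (hS : IsMinWeightSupport D S) => hS
  have hinj : Set.InjOn (fun p : Finset ι × K => p.2 • g p.1)
      ({S | IsMinWeightSupport D S} ×ˢ {r | r ≠ 0}) := by
    rintro ⟨S, r⟩ ⟨hS : IsMinWeightSupport D S, hr : r ≠ 0⟩ ⟨T, s⟩
      ⟨hT : IsMinWeightSupport D T, hs : s ≠ 0⟩ (heq : r • g S = s • g T)
    have hST : S = T := by
      rw [← Finset.coe_inj, ← hgS S hS, ← hgS T hT,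
        ← Function.support_const_smul_of_ne_zero r (g S) hr, heq,
        Function.support_const_smul_of_ne_zero s (g T) hs]
    subst hST
    exact Prod.ext rfl (smul_left_injective K (hg S hS).2.1 heq)
  have himg : {v | IsMinWeight D v} = (fun p : Finset ι × K => p.2 • g p.1) ''
      ({S | IsMinWeightSupport D S} ×ˢ {r | r ≠ 0}) := by
    ext v
    refine ⟨fun hv => ?_, ?_⟩
    · have hvS := ((Function.support v).toFinite.coe_toFinset).symm
      have hS : IsMinWeightSupport D (Function.support v).toFinite.toFinset := ⟨v, hv, hvS⟩
      obtain ⟨r, hr, hrv⟩ := (hg _ hS).exists_smul_eq hv ((hgS _ hS).trans hvS.symm)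
      exact ⟨(_, r), ⟨hS, hr⟩, hrv⟩
    · rintro ⟨⟨S, r⟩, ⟨hS, hr⟩, rfl⟩
      exact (hg S hS).smul hr
  have hcard : {r : K | r ≠ 0}.ncard = Fintype.card K - 1 := by
    rw [← Set.compl_singleton_eq, Set.ncard_compl, Set.ncard_singleton, Nat.card_eq_fintype_card]
  rw [numMinWeight, himg, hinj.ncard_image, Set.ncard_prod, hcard]

theorem numMinWeight_div_card_sub_one [Fintype K] (D : Submodule K (ι → K)) :
    (numMinWeight D : ℚ) / (Fintype.card K - 1) =
      {S : Finset ι | IsMinWeightSupport D S}.ncard := by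
  have hK : (1 : ℚ) < Fintype.card K := by exact_mod_cast Fintype.one_lt_card
  rw [numMinWeight_eq_mul, Nat.cast_mul, Nat.cast_sub Fintype.card_pos, Nat.cast_one,
    mul_div_cancel_right₀ _ (sub_pos.2 hK).ne']

end LinCode

section Collinear

variable {K : Type*} [Field K]

theorem isCollinear_iff_exists_dual {V : Type*} [AddCommGroup V] [Module K V]
    (hV : Module.finrank K V = 3) {T : Set (ℙ K V)} :
    Projectivization.IsCollinear T ↔
      ∃ φ : Module.Dual K V, φ ≠ 0 ∧ ∀ P ∈ T, φ P.rep = 0 := by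
  have : FiniteDimensional K V := Module.finite_of_finrank_eq_succ hV
  constructor
  · rintro ⟨M, -, hM, hT⟩
    obtain ⟨φ, hφ, hle⟩ := Submodule.exists_le_ker_of_lt_top M.submodule
      (Submodule.lt_top_of_finrank_lt_finrank (by omega))
    refine ⟨φ, hφ, fun P hP => LinearMap.mem_ker.1 (hle ?_)⟩
    rw [Projectivization.Subspace.mem_submodule_iff M P.rep_nonzero, P.mk_rep]
    exact hT hP
  · rintro ⟨φ, hφ, h⟩
    refine ⟨(LinearMap.ker φ).projectivization, inferInstance, ?_, fun P hP => ?_⟩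
    · rw [Projectivization.Subspace.submodule.apply_symm_apply]
      have := Module.Dual.finrank_ker_add_one_of_ne_zero hφ
      omega
    · rw [← P.mk_rep]
      exact (Submodule.mk_mem_projectivization_iff _ P.rep_nonzero).2 (h P hP)

theorem isCollinear_iff_exists_dotProduct {T : Set (ℙ K (Fin 3 → K))} :
    Projectivization.IsCollinear T ↔ ∃ l : Fin 3 → K, l ≠ 0 ∧ ∀ P ∈ T, l ⬝ᵥ P.rep = 0 := by
  rw [isCollinear_iff_exists_dual (Module.finrank_fin_fun K),
    (dotProductEquiv K (Fin 3)).surjective.exists]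
  simp only [ne_eq, EmbeddingLike.map_eq_zero_iff, dotProductEquiv_apply_apply]

end Collinear

section Forms

open MvPolynomial

open scoped Matrix

variable {σ R : Type*} [CommRing R]

theorem coeff_aeval_of_isHomogeneous {f : MvPolynomial σ R} {d n : ℕ} (hf : f.IsHomogeneous d)
    {g : σ → Polynomial R} (hg : ∀ i, (g i).natDegree ≤ n) :
    (aeval g f).coeff (d * n) = eval (fun i => (g i).coeff n) f := by
  rw [aeval_def, eval₂_eq, eval_eq, Polynomial.finsetSum_coeff]
  refine Finset.sum_congr rfl fun s hs => ?_
  have hd : s.toMultiset.card = d := by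
    rw [Finsupp.card_toMultiset, ← hf (mem_support_iff.1 hs), Finsupp.weight_apply]
    simp [Finsupp.sum]
  have hprod {A : Type _} [CommMonoid A] (h : σ → A) :
      ∏ i ∈ s.support, h i ^ s i = (s.toMultiset.map h).prod := by
    classical
    simp only [Finset.prod_multiset_map_count, Finsupp.toFinset_toMultiset,
      Finsupp.count_toMultiset]
  rw [Polynomial.algebraMap_eq, Polynomial.coeff_C_mul, hprod, hprod, ← hd]
  have hcoeff := Polynomial.coeff_multiset_prod_of_natDegree_le (s.toMultiset.map g) n
    (by simpa using fun i _ => hg i)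
  simpa using congrArg _ hcoeff

theorem exists_polynomial_eval_line (u w : σ → R) {f : MvPolynomial σ R} {d : ℕ}
    (hf : f.IsHomogeneous d) :
    ∃ F : Polynomial R, F.natDegree ≤ d ∧ F.coeff d = eval w f ∧
      ∀ t, F.eval t = eval (u + t • w) f := by
  have hdeg (i : σ) : (Polynomial.C (w i) * Polynomial.X + Polynomial.C (u i)).natDegree ≤ 1 :=
    Polynomial.natDegree_linear_le
  refine ⟨aeval (fun i => Polynomial.C (w i) * Polynomial.X + Polynomial.C (u i)) f, ?_, ?_, ?_⟩
  · simpa using aeval_natDegree_le (n := 1) f hf.totalDegree_le _ hdeg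
  · simpa using coeff_aeval_of_isHomogeneous hf hdeg
  · intro t
    have hcomp : (Polynomial.aeval t).comp
        (aeval fun i => Polynomial.C (w i) * Polynomial.X + Polynomial.C (u i)) =
        aeval (R := R) (u + t • w) := by
      ext i
      simp [add_comm, mul_comm t]
    exact DFunLike.congr_fun hcomp f

theorem exists_linearForm [Fintype σ] (l : σ → R) :
    ∃ f : MvPolynomial σ R, f.IsHomogeneous 1 ∧ ∀ v, eval v f = l ⬝ᵥ v :=
  ⟨∑ i, C (l i) * X i, IsHomogeneous.sum _ _ _ fun i _ => (isHomogeneous_X R i).C_mul _,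
    fun v => by simp [dotProduct]⟩

theorem cross_ne_zero_of_ne {v w : Fin 3 → R} (hv : v 2 = 1) (hw : w 2 = 1) (hvw : v ≠ w) :
    v ⨯₃ w ≠ 0 := by
  intro h
  have h0 := congrFun h 0
  have h1 := congrFun h 1
  simp only [cross_apply, hv, hw, Matrix.cons_val, Pi.zero_apply] at h0 h1
  refine hvw (funext fun n => ?_)
  fin_cases n
  · change v 0 = w 0
    linear_combination -h1
  · change v 1 = w 1
    linear_combination h0
  · exact hv.trans hw.symm

variable [IsDomain R] {ι : Type*}

theorem exists_form_separating {o : σ} {p : ι → σ → R} (hp : Function.Injective p)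
    (ho : ∀ i, p i o = 1) {i : ι} {T : Finset ι} (hi : i ∉ T) {e : ℕ} (he : T.card ≤ e) :
    ∃ f : MvPolynomial σ R, f.IsHomogeneous e ∧ eval (p i) f ≠ 0 ∧
      ∀ j ∈ T, eval (p j) f = 0 := by
  have hcoord (j) (hj : j ∈ T) : ∃ k, p i k ≠ p j k :=
    Function.ne_iff.1 (hp.ne fun h => hi (h ▸ hj))
  have : Nonempty σ := ⟨o⟩
  choose! k hk using hcoord
  refine ⟨(∏ j ∈ T, (X (k j) - C (p j (k j)) * X o)) * X o ^ (e - T.card), ?_, ?_, fun j hj => ?_⟩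
  · have hlin (j : ι) : (X (k j) - C (p j (k j)) * X o).IsHomogeneous 1 :=
      (isHomogeneous_X R _).sub ((isHomogeneous_X R o).C_mul _)
    have := (IsHomogeneous.prod T _ _ fun j _ => hlin j).mul
      ((isHomogeneous_X R o).pow (e - T.card))
    simpa [Nat.add_sub_cancel' he] using this
  · simpa [ho, Finset.prod_eq_zero_iff, sub_eq_zero] using hk
  · rw [map_mul, map_prod, Finset.prod_eq_zero hj (by simp [ho]), zero_mul]

theorem exists_form_isolating_of_not_collinear {p : ι → Fin 3 → R} (hp : Function.Injective p)
    (ho : ∀ i, p i 2 = 1) {S : Finset ι} {e : ℕ} (hcard : S.card = e + 2)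
    (hS : ∀ l : Fin 3 → R, l ≠ 0 → ∃ i ∈ S, l ⬝ᵥ p i ≠ 0) :
    ∃ f : MvPolynomial (Fin 3) R, f.IsHomogeneous e ∧
      ∃ i ∈ S, eval (p i) f ≠ 0 ∧ ∀ j ∈ S, j ≠ i → eval (p j) f = 0 := by
  classical
  obtain ⟨j, hj, k, hk, hjk⟩ := Finset.one_lt_card.1 (by omega : 1 < S.card)
  obtain ⟨i, hi, hline_i⟩ := hS _ (cross_ne_zero_of_ne (ho j) (ho k) (hp.ne hjk))
  have hij : j ≠ i := by
    rintro rfl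
    exact hline_i ((dotProduct_comm _ _).trans (dot_self_cross _ _))
  have hik : k ≠ i := by
    rintro rfl
    exact hline_i ((dotProduct_comm _ _).trans (dot_cross_self _ _))
  have hsub : ({i, j, k} : Finset ι) ⊆ S := by simp [Finset.insert_subset_iff, hi, hj, hk]
  have h3 : ({i, j, k} : Finset ι).card = 3 := Finset.card_eq_three.2
    ⟨i, j, k, hij.symm, hik.symm, hjk, rfl⟩
  have hle := Finset.card_le_card hsub
  obtain ⟨n, rfl⟩ : ∃ n, e = n + 1 := ⟨e - 1, by omega⟩
  obtain ⟨f, hf, hfi, hf0⟩ := exists_form_separating hp ho (i := i) (T := S \ {i, j, k})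
    (by simp) (e := n) (by rw [Finset.card_sdiff_of_subset hsub]; omega)
  obtain ⟨g, hg, hgl⟩ := exists_linearForm (p j ⨯₃ p k)
  refine ⟨f * g, hf.mul hg, i, hi, ?_, fun m hm hmi => ?_⟩
  · rw [map_mul, hgl]
    exact mul_ne_zero hfi hline_i
  · rw [map_mul, hgl]
    rcases eq_or_ne m j with rfl | hmj
    · rw [dotProduct_comm, dot_self_cross, mul_zero]
    rcases eq_or_ne m k with rfl | hmk
    · rw [dotProduct_comm, dot_cross_self, mul_zero]
    rw [hf0 m (by simp [hm, hmi, hmj, hmk]), zero_mul]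

end Forms

namespace Hermitian

open MvPolynomial

section Points

variable {K : Type*} [Field K] {q : ℕ}

theorem eval_curveForm (v : Fin 3 → K) :
    eval v (curveForm K q) = v 1 ^ q * v 2 + v 1 * v 2 ^ q - v 0 ^ (q + 1) := by
  simp [curveForm]

theorem eval_smul_curveForm (r : K) (v : Fin 3 → K) :
    eval (r • v) (curveForm K q) = r ^ (q + 1) * eval v (curveForm K q) := by
  simp only [eval_curveForm, Pi.smul_apply, smul_eq_mul]
  ring

/-- The coordinate `x` of a point of `B`, written as `(x : y : 1)`. -/
noncomputable def xCoord (P : affinePoints K q) : K := affineRep K P.1 0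

/-- The coordinate `y` of a point of `B`, written as `(x : y : 1)`. -/
noncomputable def yCoord (P : affinePoints K q) : K := affineRep K P.1 1

theorem exists_coords_eq {x y : K} (h : y ^ q + y = x ^ (q + 1)) :
    ∃ P : affinePoints K q, xCoord P = x ∧ yCoord P = y := by
  have hv : (![x, y, 1] : Fin 3 → K) ≠ 0 := fun h => one_ne_zero (congrFun h 2)
  obtain ⟨r, hr⟩ := Projectivization.exists_smul_eq_mk_rep K _ hv
  have hcurve : Projectivization.mk K _ hv ∈ rationalPoints K q := by
    rw [rationalPoints, Set.mem_ofPred_eq, ← hr, Units.smul_def, eval_smul_curveForm,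
      eval_curveForm]
    simp [h]
  have hne : Projectivization.mk K _ hv ≠ pInfty K := fun hP => by
    obtain ⟨s, hs⟩ := (Projectivization.mk_eq_mk_iff' K _ _ _ _).1 hP
    simpa using congrFun hs 2
  refine ⟨⟨_, hcurve, hne⟩, ?_, ?_⟩ <;> simp [xCoord, yCoord, affineRep, ← hr, Units.smul_def]

variable [NeZero q]

theorem rep_two_ne_zero (P : affinePoints K q) : P.1.rep 2 ≠ 0 := by
  intro h2
  have h : eval P.1.rep (curveForm K q) = 0 := P.2.1
  have h0 : P.1.rep 0 = 0 := by simpa [eval_curveForm, h2, NeZero.ne q] using h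
  refine P.2.2 ?_
  rw [Set.mem_singleton_iff, ← P.1.mk_rep, pInfty, Projectivization.mk_eq_mk_iff']
  refine ⟨P.1.rep 1, ?_⟩
  ext i
  fin_cases i <;> simp [h0, h2]

theorem affineRep_two (P : affinePoints K q) : affineRep K P.1 2 = 1 :=
  inv_mul_cancel₀ (rep_two_ne_zero P)

theorem affineRep_eq (P : affinePoints K q) :
    affineRep K P.1 = ![xCoord P, yCoord P, 1] := by
  ext i
  fin_cases i
  exacts [rfl, rfl, affineRep_two P]

theorem rep_eq_smul_affineRep (P : affinePoints K q) :
    P.1.rep = P.1.rep 2 • affineRep K P.1 := by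
  rw [affineRep, smul_inv_smul₀ (rep_two_ne_zero P)]

theorem affineRep_injective :
    Function.Injective fun P : affinePoints K q => affineRep K P.1 := by
  intro P Q (h : affineRep K P.1 = affineRep K Q.1)
  rw [Subtype.ext_iff, ← P.1.mk_rep, ← Q.1.mk_rep, Projectivization.mk_eq_mk_iff']
  refine ⟨P.1.rep 2 * (Q.1.rep 2)⁻¹, ?_⟩
  rw [mul_smul, ← affineRep, ← h, ← rep_eq_smul_affineRep]

theorem eq_of_coords_eq {P Q : affinePoints K q} (hx : xCoord P = xCoord Q)
    (hy : yCoord P = yCoord Q) : P = Q :=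
  affineRep_injective (by simp only [affineRep_eq, hx, hy])

theorem curve_equation (P : affinePoints K q) :
    yCoord P ^ q + yCoord P = xCoord P ^ (q + 1) := by
  have h : eval P.1.rep (curveForm K q) = 0 := P.2.1
  rw [rep_eq_smul_affineRep, eval_smul_curveForm, affineRep_eq] at h
  have := (mul_eq_zero.1 h).resolve_left (pow_ne_zero _ (rep_two_ne_zero P))
  simpa [eval_curveForm, sub_eq_zero] using this

theorem dotProduct_rep_eq_zero_iff (l : Fin 3 → K) (P : affinePoints K q) :
    l ⬝ᵥ P.1.rep = 0 ↔ l ⬝ᵥ affineRep K P.1 = 0 := by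
  rw [rep_eq_smul_affineRep, dotProduct_smul, smul_eq_mul, mul_eq_zero,
    or_iff_right (rep_two_ne_zero P)]

theorem dotProduct_affineRep (l : Fin 3 → K) (P : affinePoints K q) :
    l ⬝ᵥ affineRep K P.1 = l 0 * xCoord P + l 1 * yCoord P + l 2 := by
  simp [affineRep_eq, dotProduct, Fin.sum_univ_three]

theorem dotProduct_rep_pInfty_eq_zero_iff (l : Fin 3 → K) :
    l ⬝ᵥ (pInfty K).rep = 0 ↔ l 1 = 0 := by
  have hv : (![0, 1, 0] : Fin 3 → K) ≠ 0 := fun h => one_ne_zero (congrFun h 1)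
  obtain ⟨r, hr⟩ := Projectivization.exists_smul_eq_mk_rep K _ hv
  rw [pInfty, ← hr, Units.smul_def, dotProduct_smul, smul_eq_mul, mul_eq_zero,
    or_iff_right r.ne_zero]
  simp [dotProduct, Fin.sum_univ_three]

end Points

section Lines

variable {K : Type*} [Field K] [Fintype K] [DecidableEq K] {q : ℕ}

/-- The points of `B` on a line of the projective plane other than `z = 0`: the line `x = c` is
encoded as `.inl c` and the line `y = m x + b` as `.inr (m, b)`. -/
noncomputable def linePoints (q : ℕ) : K ⊕ K × K → Finset (affinePoints K q)
  | .inl c => {P | xCoord P = c}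
  | .inr (m, b) => {P | yCoord P = m * xCoord P + b}

theorem mem_linePoints_inl {c : K} {P : affinePoints K q} :
    P ∈ linePoints q (.inl c) ↔ xCoord P = c :=
  Finset.mem_filter_univ P

theorem mem_linePoints_inr {m b : K} {P : affinePoints K q} :
    P ∈ linePoints q (.inr (m, b)) ↔ yCoord P = m * xCoord P + b :=
  Finset.mem_filter_univ P

variable [NeZero q]

theorem xCoord_injOn_linePoints_inr (m b : K) :
    Set.InjOn xCoord (linePoints q (.inr (m, b)) : Set (affinePoints K q)) := by
  intro P hP Q hQ hx
  rw [Finset.mem_coe, mem_linePoints_inr] at hP hQ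
  exact eq_of_coords_eq hx (by rw [hP, hQ, hx])

theorem yCoord_injOn_linePoints_inl (c : K) :
    Set.InjOn yCoord (linePoints q (.inl c) : Set (affinePoints K q)) := by
  intro P hP Q hQ hy
  rw [Finset.mem_coe, mem_linePoints_inl] at hP hQ
  exact eq_of_coords_eq (hP.trans hQ.symm) hy

theorem line_eq_of_mem_linePoints {l l' : K ⊕ K × K} {P Q : affinePoints K q} (hPQ : P ≠ Q)
    (hP : P ∈ linePoints q l) (hQ : Q ∈ linePoints q l) (hP' : P ∈ linePoints q l')
    (hQ' : Q ∈ linePoints q l') : l = l' := by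
  have hx {m b : K} (hP : P ∈ linePoints q (.inr (m, b))) (hQ : Q ∈ linePoints q (.inr (m, b))) :
      xCoord P ≠ xCoord Q :=
    (xCoord_injOn_linePoints_inr m b).ne hP hQ hPQ
  rcases l with c | ⟨m, b⟩ <;> rcases l' with c' | ⟨m', b'⟩
  · rw [mem_linePoints_inl] at hP hP'
    rw [← hP, ← hP']
  · rw [mem_linePoints_inl] at hP hQ
    exact absurd (hP.trans hQ.symm) (hx hP' hQ')
  · rw [mem_linePoints_inl] at hP' hQ'
    exact absurd (hP'.trans hQ'.symm) (hx hP hQ)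
  · have hne := sub_ne_zero.2 (hx hP hQ)
    rw [mem_linePoints_inr] at hP hQ hP' hQ'
    obtain rfl : m = m' := mul_right_cancel₀ hne (by linear_combination hQ - hP + hP' - hQ')
    obtain rfl : b = b' := by linear_combination hP' - hP
    rfl

theorem exists_subset_linePoints_inl {l : Fin 3 → K} (hl : l ≠ 0) (h1 : l 1 = 0)
    {S : Finset (affinePoints K q)} (hS : ∀ P ∈ S, l ⬝ᵥ affineRep K P.1 = 0) :
    ∃ c, S ⊆ linePoints q (.inl c) := by
  simp only [dotProduct_affineRep, h1, zero_mul, add_zero] at hS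
  by_cases h0 : l 0 = 0
  · refine ⟨0, fun P hP => absurd ?_ hl⟩
    ext i
    fin_cases i
    exacts [h0, h1, by simpa [h0] using hS P hP]
  · refine ⟨-l 2 / l 0, fun P hP => ?_⟩
    rw [mem_linePoints_inl, eq_div_iff h0]
    linear_combination hS P hP

theorem isCollinear_iff_subset_linePoints {S : Finset (affinePoints K q)} :
    Projectivization.IsCollinear (Subtype.val '' (S : Set (affinePoints K q))) ↔
      ∃ l, S ⊆ linePoints q l := by
  simp only [isCollinear_iff_exists_dotProduct, Set.forall_mem_image, Finset.mem_coe,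
    dotProduct_rep_eq_zero_iff]
  constructor
  · rintro ⟨l, hl, hS⟩
    by_cases h1 : l 1 = 0
    · obtain ⟨c, hc⟩ := exists_subset_linePoints_inl hl h1 fun P hP => hS hP
      exact ⟨_, hc⟩
    · refine ⟨.inr (-l 0 / l 1, -l 2 / l 1), fun P hP => ?_⟩
      have hP := hS hP
      rw [dotProduct_affineRep] at hP
      rw [mem_linePoints_inr]
      field_simp
      linear_combination hP
  · rintro ⟨c | ⟨m, b⟩, hS⟩
    · refine ⟨![1, 0, -c], fun h0 => one_ne_zero (congrFun h0 0), fun P hP => ?_⟩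
      rw [dotProduct_affineRep, mem_linePoints_inl.1 (hS hP)]
      simp
    · refine ⟨![m, -1, b], fun h0 => by simpa using congrFun h0 1, fun P hP => ?_⟩
      rw [dotProduct_affineRep, mem_linePoints_inr.1 (hS hP)]
      simp

theorem isCollinear_insert_pInfty_iff_subset_linePoints {S : Finset (affinePoints K q)} :
    Projectivization.IsCollinear
        (insert (pInfty K) (Subtype.val '' (S : Set (affinePoints K q)))) ↔
      ∃ c, S ⊆ linePoints q (.inl c) := by
  simp only [isCollinear_iff_exists_dotProduct, Set.forall_mem_insert, Set.forall_mem_image,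
    Finset.mem_coe, dotProduct_rep_eq_zero_iff, dotProduct_rep_pInfty_eq_zero_iff]
  constructor
  · rintro ⟨l, hl, h1, hS⟩
    exact exists_subset_linePoints_inl hl h1 fun P hP => hS hP
  · rintro ⟨c, hS⟩
    refine ⟨![1, 0, -c], fun h0 => one_ne_zero (congrFun h0 0), rfl, fun P hP => ?_⟩
    rw [dotProduct_affineRep, mem_linePoints_inl.1 (hS hP)]
    simp

end Lines

section LineCount

variable {K : Type*} [Field K] [Fintype K] {q : ℕ} (hK : Fintype.card K = q ^ 2)

include hK

theorem slanted_equation_iff (m b x : K) :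
    (m * x + b) ^ q + (m * x + b) = x ^ (q + 1) ↔
      (x - m ^ q) ^ (q + 1) = b ^ q + b + m ^ (q + 1) := by
  rw [add_pow_eq hK, pow_succ (x - m ^ q), sub_pow_eq hK, pow_pow_eq_self hK, mul_pow,
    pow_succ, pow_succ]
  constructor <;> intro h <;> linear_combination -h

variable [DecidableEq K] [NeZero q]

theorem card_linePoints_inl (c : K) : (linePoints q (.inl c : K ⊕ K × K)).card = q := by
  refine Eq.trans ?_ (card_trace_fiber hK (norm_pow_eq hK c))
  refine Finset.card_bij (fun P _ => yCoord P) (fun P hP => ?_) (yCoord_injOn_linePoints_inl c)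
    fun y hy => ?_
  · simp [curve_equation P, mem_linePoints_inl.1 hP]
  · obtain ⟨P, hx, hy⟩ := exists_coords_eq (by simpa using hy)
    exact ⟨P, mem_linePoints_inl.2 hx, hy⟩

theorem card_linePoints_inr (m b : K) :
    (linePoints q (.inr (m, b) : K ⊕ K × K)).card =
      if b ^ q + b = -m ^ (q + 1) then 1 else q + 1 := by
  have hfiber : (linePoints q (.inr (m, b) : K ⊕ K × K)).card =
      ({u | u ^ (q + 1) = b ^ q + b + m ^ (q + 1)} : Finset K).card := by
    refine Finset.card_bij (fun P _ => xCoord P - m ^ q) (fun P hP => ?_)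
      (fun P hP Q hQ h => xCoord_injOn_linePoints_inr m b hP hQ (sub_left_injective h))
      fun u hu => ?_
    · have hcurve := curve_equation P
      rw [mem_linePoints_inr.1 hP, slanted_equation_iff hK] at hcurve
      simpa using hcurve
    · obtain ⟨P, hx, hy⟩ := exists_coords_eq ((slanted_equation_iff hK m b (u + m ^ q)).2
        (by simpa using hu))
      exact ⟨P, mem_linePoints_inr.2 (by rw [hy, hx]), by rw [hx, add_sub_cancel_right]⟩
  rw [hfiber]
  split_ifs with h <;> rw [← add_eq_zero_iff_eq_neg] at h
  · simp [h, Finset.filter_eq']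
  · refine card_norm_fiber hK ?_ h
    rw [add_pow_eq hK, trace_pow_eq hK, norm_pow_eq hK]

omit [NeZero q] in
theorem card_tangents_of_slope (m : K) : ({b | b ^ q + b = -m ^ (q + 1)} : Finset K).card = q :=
  card_trace_fiber hK (by rw [neg_pow_eq hK, norm_pow_eq hK])

theorem card_linePoints_inr_one_zero : (linePoints q (.inr (1, 0) : K ⊕ K × K)).card = q + 1 := by
  rw [card_linePoints_inr hK, if_neg (by simp [NeZero.ne q])]

omit [DecidableEq K] in
theorem ncard_collinear_insert_pInfty {k : ℕ} (hk : 2 ≤ k) :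
    {S : Finset (affinePoints K q) | S.card = k ∧ Projectivization.IsCollinear
      (insert (pInfty K) (Subtype.val '' (S : Set (affinePoints K q))))}.ncard =
      q ^ 2 * q.choose k := by
  classical
  simp only [isCollinear_insert_pInfty_iff_subset_linePoints]
  rw [ncard_subsets_of_lines (fun hPQ hP hQ hP' hQ' =>
    Sum.inl_injective (line_eq_of_mem_linePoints hPQ hP hQ hP' hQ')) hk]
  simp only [card_linePoints_inl hK, Finset.sum_const, Finset.card_univ, hK, smul_eq_mul]

omit [DecidableEq K] in
theorem ncard_collinear {k : ℕ} (hk : 2 ≤ k) :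
    {S : Finset (affinePoints K q) | S.card = k ∧ Projectivization.IsCollinear
      (Subtype.val '' (S : Set (affinePoints K q)))}.ncard =
      q ^ 2 * q.choose k + (q ^ 4 - q ^ 3) * (q + 1).choose k := by
  classical
  have hslope (m : K) : ∑ b, (linePoints q (.inr (m, b) : K ⊕ K × K)).card.choose k =
      (q ^ 2 - q) * (q + 1).choose k := by
    have hcard := Finset.card_filter_add_card_filter_not (s := Finset.univ)
      fun b : K => b ^ q + b = -m ^ (q + 1)
    rw [card_tangents_of_slope hK, Finset.card_univ, hK] at hcard
    simp only [card_linePoints_inr hK, apply_ite (Nat.choose · k), Nat.choose_eq_zero_of_lt hk]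
    rw [Finset.sum_ite, Finset.sum_const_zero, zero_add, Finset.sum_const, smul_eq_mul,
      Nat.eq_sub_of_add_eq' hcard]
  simp only [isCollinear_iff_subset_linePoints]
  rw [ncard_subsets_of_lines line_eq_of_mem_linePoints hk, Fintype.sum_sum_type,
    Fintype.sum_prod_type]
  simp only [card_linePoints_inl hK, hslope, Finset.sum_const, Finset.card_univ, hK, smul_eq_mul]
  rw [← mul_assoc, Nat.mul_sub]
  ring_nf

end LineCount

section Sections

variable {K : Type*} [Field K] {q : ℕ}

theorem toChart_X (i : Fin 3) :
    toChart K q (X i) = Ideal.Quotient.mk _ ((![X 0, 1, X 1] : Fin 3 → MvPolynomial (Fin 2) K) i) :=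
  congrArg (Ideal.Quotient.mk _) (aeval_X _ i)

theorem toChart_X_zero_mem : toChart K q (X 0) ∈ idealPInfty K q :=
  Ideal.subset_span (Or.inl (toChart_X 0))

theorem toChart_X_two_mem : toChart K q (X 2) ∈ idealPInfty K q :=
  Ideal.subset_span (Or.inr (toChart_X 2))

theorem toChart_curveForm : toChart K q (curveForm K q) = 0 :=
  Ideal.Quotient.eq_zero_iff_mem.2 (Ideal.subset_span rfl)

theorem toChart_X_two_mem_pow : toChart K q (X 2) ∈ idealPInfty K q ^ q := by
  have hcurve := toChart_curveForm (K := K) (q := q)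
  have h1 : toChart K q (X 1) = 1 := toChart_X 1
  simp only [curveForm, map_sub, map_add, map_mul, map_pow, h1, one_pow, one_mul] at hcurve
  have hz : toChart K q (X 2) = toChart K q (X 0) ^ (q + 1) - toChart K q (X 2) ^ q := by
    linear_combination hcurve
  rw [hz]
  exact sub_mem (Ideal.pow_le_pow_right q.le_succ (Ideal.pow_mem_pow toChart_X_zero_mem _))
    (Ideal.pow_mem_pow toChart_X_two_mem _)

theorem prod_vertical_mem_sections {ι : Type*} {a : ℕ} {T : Finset ι} (c : ι → K)
    (ha : a ≤ T.card) : ∏ i ∈ T, (X 0 - C (c i) * X 2) ∈ sections K q T.card a := by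
  constructor
  · simpa using IsHomogeneous.prod T (fun i => X 0 - C (c i) * X 2) (fun _ => 1)
      fun i _ => (isHomogeneous_X K (0 : Fin 3)).sub ((isHomogeneous_X K 2).C_mul _)
  · have hmem : ∀ i ∈ T, toChart K q (X 0 - C (c i) * X 2) ∈ idealPInfty K q := fun i _ => by
      rw [map_sub, map_mul]
      exact sub_mem toChart_X_zero_mem (Ideal.mul_mem_left _ _ toChart_X_two_mem)
    have hprod := Ideal.prod_mem_prod hmem
    rw [Finset.prod_const, ← map_prod] at hprod
    exact Ideal.pow_le_pow_right ha hprod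

theorem eval_dehomog (v : Fin 2 → K) (f : MvPolynomial (Fin 3) K) :
    eval v (dehomog K f) = eval ![v 0, 1, v 1] f := by
  have hcomp : (aeval v).comp (dehomog K) = aeval (R := K) ![v 0, 1, v 1] := by
    ext i
    fin_cases i <;> simp [dehomog]
  exact DFunLike.congr_fun hcomp f

theorem eval_pInfty_eq_zero [NeZero q] {d a : ℕ} (ha : 0 < a) {f : MvPolynomial (Fin 3) K}
    (hf : f ∈ sections K q d a) : eval ![0, 1, 0] f = 0 := by
  have hcurve : ∀ g ∈ Ideal.span {dehomog K (curveForm K q)}, eval (0 : Fin 2 → K) g = 0 := by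
    intro g hg
    obtain ⟨h, rfl⟩ := Ideal.mem_span_singleton.1 hg
    rw [map_mul, eval_dehomog, eval_curveForm]
    simp [NeZero.ne q]
  let evalOrigin : ChartRing K q →+* K := Ideal.Quotient.lift _ (eval (0 : Fin 2 → K)) hcurve
  have hle : idealPInfty K q ≤ RingHom.ker evalOrigin := by
    refine Ideal.span_le.2 ?_
    rintro _ (rfl | rfl) <;> simp [evalOrigin]
  have hzero : evalOrigin (toChart K q f) = 0 := hle (Ideal.pow_le_self ha.ne' hf.2)
  exact (eval_dehomog 0 f).symm.trans hzero

end Sections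

section DualWords

variable {K : Type*} [Field K] {q : ℕ}

theorem evalMap_apply (f : MvPolynomial (Fin 3) K) (P : affinePoints K q) :
    evalMap K q f P = eval (affineRep K P.1) f :=
  rfl

theorem evalMap_mem_code_zero {e : ℕ} {f : MvPolynomial (Fin 3) K} (hf : f.IsHomogeneous e) :
    evalMap K q f ∈ code K q e 0 :=
  Submodule.mem_map_of_mem ⟨hf, by simp⟩

variable [NeZero q]

theorem code_zero_le_code_succ {e a : ℕ} (ha : a ≤ q) : code K q e 0 ≤ code K q (e + 1) a := by
  rintro _ ⟨f, hf, rfl⟩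
  refine ⟨f * X 2, ⟨hf.1.mul (isHomogeneous_X K 2), ?_⟩, ?_⟩
  · change toChart K q (f * X 2) ∈ idealPInfty K q ^ a
    rw [map_mul]
    exact Ideal.mul_mem_left _ _ (Ideal.pow_le_pow_right ha toChart_X_two_mem_pow)
  · ext P
    rw [evalMap_apply, evalMap_apply, map_mul, eval_X, affineRep_two, mul_one]

variable [Fintype K]

theorem add_two_le_hammingNorm [DecidableEq K] {e : ℕ} {v : affinePoints K q → K}
    (hv : v ∈ LinCode.dual (code K q e 0)) (hv0 : v ≠ 0) : e + 2 ≤ hammingNorm v := by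
  classical
  by_contra! hlt
  obtain ⟨P, hP : v P ≠ 0⟩ := Function.ne_iff.1 hv0
  have hcard : (({Q | v Q ≠ 0} : Finset _).erase P).card + 1 = hammingNorm v :=
    Finset.card_erase_add_one (by simpa using hP)
  obtain ⟨f, hf, hfP, hf0⟩ := exists_form_separating affineRep_injective affineRep_two
    (Finset.notMem_erase P {Q | v Q ≠ 0}) (e := e) (by omega)
  exact hP (LinCode.apply_eq_zero_of_mem_dual hv (evalMap_mem_code_zero hf) hfP
    fun Q hQP hQ => hf0 Q (by simp [hQP, hQ]))

theorem isCollinear_of_mem_dual {e : ℕ} {v : affinePoints K q → K}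
    (hv : v ∈ LinCode.dual (code K q e 0)) {S : Finset (affinePoints K q)}
    (hS : Function.support v = S) (hcard : S.card = e + 2) :
    Projectivization.IsCollinear (Subtype.val '' (S : Set (affinePoints K q))) := by
  by_contra hcol
  simp only [isCollinear_iff_exists_dotProduct, Set.forall_mem_image, Finset.mem_coe,
    dotProduct_rep_eq_zero_iff] at hcol
  push Not at hcol
  obtain ⟨f, hf, P, hP, hfP, hf0⟩ :=
    exists_form_isolating_of_not_collinear affineRep_injective affineRep_two hcard hcol
  have hsupp (Q : affinePoints K q) : v Q ≠ 0 ↔ Q ∈ S := Set.ext_iff.1 hS Q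
  exact (hsupp P).2 hP (LinCode.apply_eq_zero_of_mem_dual hv (evalMap_mem_code_zero hf) hfP
    fun Q hQP hQ => hf0 Q ((hsupp Q).1 hQ) hQP)

variable [DecidableEq K]

theorem exists_subset_linePoints_inl_of_mem_dual {d a : ℕ} (had : a ≤ d)
    {v : affinePoints K q → K} (hv : v ∈ LinCode.dual (code K q d a))
    {S : Finset (affinePoints K q)} (hS : Function.support v = S) (hcard : S.card = d + 1)
    {l : K ⊕ K × K} (hl : S ⊆ linePoints q l) : ∃ c, S ⊆ linePoints q (.inl c) := by
  rcases l with c | ⟨m, b⟩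
  · exact ⟨c, hl⟩
  classical
  have hsupp (Q : affinePoints K q) : v Q ≠ 0 ↔ Q ∈ S := Set.ext_iff.1 hS Q
  obtain ⟨P, hP⟩ := Finset.card_pos.1 (by omega : 0 < S.card)
  have hT : (S.erase P).card = d := by
    rw [Finset.card_erase_of_mem hP, hcard, Nat.add_sub_cancel]
  have hsec := prod_vertical_mem_sections (q := q) xCoord (had.trans hT.ge)
  rw [hT] at hsec
  have heval (Q : affinePoints K q) :
      evalMap K q (∏ R ∈ S.erase P, (X 0 - C (xCoord R) * X 2)) Q =
        ∏ R ∈ S.erase P, (xCoord Q - xCoord R) := by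
    simp [evalMap_apply, affineRep_eq]
  refine absurd (LinCode.apply_eq_zero_of_mem_dual hv (Submodule.mem_map_of_mem hsec)
    (i := P) ?_ fun Q hQP hQ => ?_) ((hsupp P).2 hP)
  · rw [heval]
    refine Finset.prod_ne_zero_iff.2 fun R hR => sub_ne_zero.2 ?_
    obtain ⟨hRP, hRS⟩ := Finset.mem_erase.1 hR
    exact (xCoord_injOn_linePoints_inr m b).ne (hl hP) (hl hRS) hRP.symm
  · rw [heval]
    exact Finset.prod_eq_zero (Finset.mem_erase.2 ⟨hQP, (hsupp Q).1 hQ⟩) (sub_self _)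

omit [NeZero q] [DecidableEq K] in
theorem exists_mem_dual_of_affineRep_eq {d a : ℕ} {u w : Fin 3 → K}
    {S : Finset (affinePoints K q)} {t : affinePoints K q → K} (ht : Set.InjOn t S)
    (hline : ∀ P ∈ S, affineRep K P.1 = u + t P • w) (hcard : d < S.card)
    (hw : S.card = d + 1 → ∀ f ∈ sections K q d a, eval w f = 0) :
    ∃ v ∈ LinCode.dual (code K q d a), Function.support v = S := by
  refine LinCode.exists_mem_dual_support_eq ht ?_
  rintro _ ⟨f, hf, rfl⟩
  obtain ⟨F, hdeg, hcoeff, heval⟩ := exists_polynomial_eval_line u w hf.1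
  refine ⟨F, ?_, ?_, fun P hP => ?_⟩
  · exact (Polynomial.degree_le_of_natDegree_le hdeg).trans_lt (by exact_mod_cast hcard)
  · rcases Nat.eq_or_lt_of_le hcard with h | h
    · rw [← h, Nat.succ_sub_one, hcoeff, hw h.symm f hf]
    · exact Polynomial.coeff_eq_zero_of_natDegree_lt (by omega)
  · rw [heval, evalMap_apply, hline P hP]

theorem exists_mem_dual_of_subset_linePoints_inl {d a : ℕ} {S : Finset (affinePoints K q)} {c : K}
    (hS : S ⊆ linePoints q (.inl c)) (hcard : d < S.card) (ha : S.card = d + 1 → 0 < a) :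
    ∃ v ∈ LinCode.dual (code K q d a), Function.support v = S := by
  refine exists_mem_dual_of_affineRep_eq (t := yCoord) (u := ![c, 0, 1]) (w := ![0, 1, 0])
    ((yCoord_injOn_linePoints_inl c).mono (Finset.coe_subset.2 hS)) (fun P hP => ?_) hcard
    fun h f hf => eval_pInfty_eq_zero (ha h) hf
  rw [affineRep_eq, mem_linePoints_inl.1 (hS hP)]
  simp

theorem exists_mem_dual_of_subset_linePoints {d a : ℕ} {S : Finset (affinePoints K q)}
    {l : K ⊕ K × K} (hS : S ⊆ linePoints q l) (hcard : d + 1 < S.card) :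
    ∃ v ∈ LinCode.dual (code K q d a), Function.support v = S := by
  have hne : S.card ≠ d + 1 := hcard.ne'
  rcases l with c | ⟨m, b⟩
  · exact exists_mem_dual_of_subset_linePoints_inl hS (by omega) fun h => absurd h hne
  · refine exists_mem_dual_of_affineRep_eq (t := xCoord) (u := ![0, b, 1]) (w := ![1, m, 0])
      ((xCoord_injOn_linePoints_inr m b).mono (Finset.coe_subset.2 hS)) (fun P hP => ?_)
      (by omega) fun h => absurd h hne
    rw [affineRep_eq, mem_linePoints_inr.1 (hS hP)]
    simp [mul_comm m, add_comm b]

omit [DecidableEq K] in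
theorem exists_mem_dual_support_eq_iff_isCollinear {d : ℕ} {S : Finset (affinePoints K q)}
    (hcard : S.card = d + 2) :
    (∃ v ∈ LinCode.dual (code K q d 0), Function.support v = S) ↔
      Projectivization.IsCollinear (Subtype.val '' (S : Set (affinePoints K q))) := by
  classical
  constructor
  · rintro ⟨v, hv, hS⟩
    exact isCollinear_of_mem_dual hv hS hcard
  · rw [isCollinear_iff_subset_linePoints]
    rintro ⟨l, hl⟩
    exact exists_mem_dual_of_subset_linePoints hl (by omega)

omit [DecidableEq K] in
theorem exists_mem_dual_support_eq_iff_isCollinear_insert_pInfty {d a : ℕ} (ha : 0 < a)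
    (had : a ≤ d) (hdq : d < q) {S : Finset (affinePoints K q)} (hcard : S.card = d + 1) :
    (∃ v ∈ LinCode.dual (code K q d a), Function.support v = S) ↔
      Projectivization.IsCollinear
        (insert (pInfty K) (Subtype.val '' (S : Set (affinePoints K q)))) := by
  classical
  rw [isCollinear_insert_pInfty_iff_subset_linePoints]
  constructor
  · rintro ⟨v, hv, hS⟩
    obtain ⟨e, rfl⟩ : ∃ e, d = e + 1 := ⟨d - 1, by omega⟩
    have hcol := isCollinear_of_mem_dual
      (LinCode.dual_anti (code_zero_le_code_succ (by omega)) hv) hS hcard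
    obtain ⟨l, hl⟩ := isCollinear_iff_subset_linePoints.1 hcol
    exact exists_subset_linePoints_inl_of_mem_dual had hv hS hcard hl
  · rintro ⟨c, hS⟩
    exact exists_mem_dual_of_subset_linePoints_inl hS (by omega) fun _ => ha

end DualWords

section MinimumWeight

variable {K : Type*} [Field K] [Fintype K] [DecidableEq K] {q : ℕ} [NeZero q]
  (hK : Fintype.card K = q ^ 2) {d : ℕ} (hdq : d < q)

include hK hdq

theorem minDist_dual_code_zero : LinCode.minDist (LinCode.dual (code K q d 0)) = (d + 2 : ℕ) := by
  obtain ⟨S, hS, hcard⟩ := Finset.exists_subset_card_eq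
    (show d + 2 ≤ (linePoints q (.inr (1, 0) : K ⊕ K × K)).card by
      rw [card_linePoints_inr_one_zero hK]; omega)
  obtain ⟨v, hv, hvS⟩ := exists_mem_dual_of_subset_linePoints (a := 0) hS (by omega : d + 1 < _)
  have hnorm := (LinCode.hammingNorm_eq_card_of_support_eq hvS).trans hcard
  exact LinCode.minDist_eq_of_forall_le (fun w => add_two_le_hammingNorm)
    ⟨v, hv, hammingNorm_ne_zero_iff.1 (by omega), hnorm⟩

theorem isMinWeightSupport_dual_code_zero_iff {S : Finset (affinePoints K q)} :
    LinCode.IsMinWeightSupport (LinCode.dual (code K q d 0)) S ↔ S.card = d + 2 ∧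
      Projectivization.IsCollinear (Subtype.val '' (S : Set (affinePoints K q))) := by
  rw [LinCode.isMinWeightSupport_iff (by omega) (minDist_dual_code_zero hK hdq)]
  exact and_congr_right exists_mem_dual_support_eq_iff_isCollinear

theorem numMinWeight_dual_code_zero_div :
    (LinCode.numMinWeight (LinCode.dual (code K q d 0)) : ℚ) / ((q : ℚ) ^ 2 - 1) =
      (q : ℚ) ^ 2 * q.choose (d + 2) + ((q : ℚ) ^ 4 - (q : ℚ) ^ 3) * (q + 1).choose (d + 2) := by
  have hle : q ^ 3 ≤ q ^ 4 := Nat.pow_le_pow_right (NeZero.pos q) (by norm_num)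
  rw [← Nat.cast_pow q 2, ← hK, LinCode.numMinWeight_div_card_sub_one]
  simp only [isMinWeightSupport_dual_code_zero_iff hK hdq]
  rw [ncard_collinear hK (by omega)]
  push_cast [Nat.cast_sub hle, hK]
  rfl

variable {a : ℕ} (ha : 0 < a) (had : a ≤ d)

include ha had

theorem minDist_dual_code_of_pos :
    LinCode.minDist (LinCode.dual (code K q d a)) = (d + 1 : ℕ) := by
  obtain ⟨S, hS, hcard⟩ := Finset.exists_subset_card_eq
    (show d + 1 ≤ (linePoints q (.inl 0 : K ⊕ K × K)).card by rw [card_linePoints_inl hK]; omega)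
  obtain ⟨v, hv, hvS⟩ := exists_mem_dual_of_subset_linePoints_inl hS (by omega : d < _) fun _ => ha
  have hnorm := (LinCode.hammingNorm_eq_card_of_support_eq hvS).trans hcard
  obtain ⟨e, rfl⟩ : ∃ e, d = e + 1 := ⟨d - 1, by omega⟩
  exact LinCode.minDist_eq_of_forall_le
    (fun w hw => add_two_le_hammingNorm
      (LinCode.dual_anti (code_zero_le_code_succ (by omega)) hw))
    ⟨v, hv, hammingNorm_ne_zero_iff.1 (by omega), hnorm⟩

theorem isMinWeightSupport_dual_code_iff_of_pos {S : Finset (affinePoints K q)} :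
    LinCode.IsMinWeightSupport (LinCode.dual (code K q d a)) S ↔ S.card = d + 1 ∧
      Projectivization.IsCollinear
        (insert (pInfty K) (Subtype.val '' (S : Set (affinePoints K q)))) := by
  rw [LinCode.isMinWeightSupport_iff (by omega) (minDist_dual_code_of_pos hK hdq ha had)]
  exact and_congr_right (exists_mem_dual_support_eq_iff_isCollinear_insert_pInfty ha had hdq)

theorem numMinWeight_dual_code_div_of_pos :
    (LinCode.numMinWeight (LinCode.dual (code K q d a)) : ℚ) / ((q : ℚ) ^ 2 - 1) =
      (q : ℚ) ^ 2 * q.choose (d + 1) := by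
  rw [← Nat.cast_pow q 2, ← hK, LinCode.numMinWeight_div_card_sub_one]
  simp only [isMinWeightSupport_dual_code_iff_of_pos hK hdq ha had]
  rw [ncard_collinear_insert_pInfty hK (by omega), hK, Nat.cast_mul]

end MinimumWeight

end Hermitian

theorem theorem4p1 {K : Type*} [Field K] [Fintype K] [DecidableEq K]
    (q : ℕ) (hq : IsPrimePow q) (hK : Fintype.card K = q ^ 2)
    (d a : ℕ) (hd : 1 ≤ d) (hdq : d ≤ q - 1) (had : a ≤ d) :
    (a = 0 →
      LinCode.minDist (LinCode.dual (Hermitian.code K q d a)) = ((d + 2 : ℕ) : ℕ∞) ∧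
      (∀ S : Finset (Hermitian.affinePoints K q),
        LinCode.IsMinWeightSupport (LinCode.dual (Hermitian.code K q d a)) S ↔
          S.card = d + 2 ∧
            Projectivization.IsCollinear (Subtype.val '' (S : Set (Hermitian.affinePoints K q)))) ∧
      (LinCode.numMinWeight (LinCode.dual (Hermitian.code K q d a)) : ℚ) / ((q : ℚ) ^ 2 - 1) =
        if d = q - 1 then (q : ℚ) ^ 4 - (q : ℚ) ^ 3
        else (q : ℚ) ^ 2 * (q.choose (d + 2) : ℚ) +
          ((q : ℚ) ^ 4 - (q : ℚ) ^ 3) * ((q + 1).choose (d + 2) : ℚ)) ∧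
    (0 < a →
      LinCode.minDist (LinCode.dual (Hermitian.code K q d a)) = ((d + 1 : ℕ) : ℕ∞) ∧
      (∀ S : Finset (Hermitian.affinePoints K q),
        LinCode.IsMinWeightSupport (LinCode.dual (Hermitian.code K q d a)) S ↔
          S.card = d + 1 ∧
            Projectivization.IsCollinear
              (insert (Hermitian.pInfty K)
                (Subtype.val '' (S : Set (Hermitian.affinePoints K q))))) ∧
      (LinCode.numMinWeight (LinCode.dual (Hermitian.code K q d a)) : ℚ) / ((q : ℚ) ^ 2 - 1) =
        (q : ℚ) ^ 2 * (q.choose (d + 1) : ℚ)) := by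
  have : NeZero q := ⟨hq.ne_zero⟩
  have hdq : d < q := Nat.lt_of_le_pred (NeZero.pos q) hdq
  constructor
  · rintro rfl
    refine ⟨Hermitian.minDist_dual_code_zero hK hdq,
      fun S => Hermitian.isMinWeightSupport_dual_code_zero_iff hK hdq, ?_⟩
    rw [Hermitian.numMinWeight_dual_code_zero_div hK hdq]
    split_ifs with h
    · rw [show d + 2 = q + 1 by omega, Nat.choose_succ_self, Nat.choose_self]
      simp
    · rfl
  · exact fun ha => ⟨Hermitian.minDist_dual_code_of_pos hK hdq ha had,
      fun S => Hermitian.isMinWeightSupport_dual_code_iff_of_pos hK hdq ha had,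
      Hermitian.numMinWeight_dual_code_div_of_pos hK hdq ha had⟩
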